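/- A coordination game with equal-split distribution rule and without individual preferences on a graph $G=(V,E)$ with $c$ colors is given by nonempty color sets $S_i\subseteq\{1,\dots,c\}$ for the players $i\in V$ and edge weights $w_e\ge 0$ for $e\in E$. In a profile $s$ with $s_i\in S_i$ for all $i$, player $i$ has utility $u_i(s)=\frac12\sum_{\{i,j\}\in E:\,s_i=s_j}w_{ij}$, and the social welfare is $u(s)=\sum_{i\in V}u_i(s)$. For $\epsilon\ge1$ and $k\ge 1$, the profile $s$ is an $(\epsilon,k)$-equilibrium if for every nonempty $K\subseteq V$ with $|K|\le k$ and all $s'_i\in S_i$ $(i\in K)$ some $j\in K$ satisfies $u_j(s_{-K},s'_K)\le\epsilon\, u_j(s)$. Let $\mathcal G_G(c)$ be the set of all such games on $G$ with $c$ colors, and let $(\epsilon,k)\text{-PoA}(\mathcal G_G(c))\in[0,\infty]$ be the supremum of $u(s^*)/u(s)$ over all games in $\mathcal G_G(c)$ and all their $(\epsilon,k)$-equilibria $s$, where $s^*$ is a profile of maximum social welfare (with $a/0=\infty$ for $a>0$ and $0/0=1$). Theorem. Let $k\ge2$ be an integer and $d>0$ a real number. There are constants $C_1,C_2>0$, depending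 only on $k$ and $d$, such that for every real $\epsilon\ge1$ and every sequence of integers $(c_n)_{n\in\mathbb N}$ with $c_n\ge3$ for all $n$, the Erdős–Rényi random graph $G_n\sim G(n,d/n)$ on $n$ nodes satisfies $$\lim_{n\to\infty}\mathbb P\left\{C_1\,\frac{\epsilon\ln n}{\ln\ln n}\;\le\;(\epsilon,k)\text{-PoA}(\mathcal G_{G_n}(c_n))\;\le\; C_2\,\frac{\epsilon\ln n}{\ln\ln n}\right\}=1 .$$ In other words, $(\epsilon,k)\text{-PoA}(\mathcal G_{G_n}(c_n))=\Theta\left(\frac{\epsilon\ln n}{\ln\ln n}\right)$ with high probability. -/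

import Mathlib

open Filter Topology

/-- A clustering game on the graph `G` with color set `Fin c`. The functions `w`, `α`, `q` are only
relevant on edges, on incident pairs, and on the available colors, respectively. -/
structure ClusteringGame {V : Type*} (G : SimpleGraph V) (c : ℕ) where
  /-- coordination edges -/
  Ec : Set (Sym2 V)
  /-- anti-coordination edges -/
  Ea : Set (Sym2 V)
  union_eq : Ec ∪ Ea = G.edgeSet
  disjoint : Disjoint Ec Ea
  /-- the colors available to each player -/
  S : V → Set (Fin c)
  S_nonempty : ∀ i, (S i).Nonempty
  /-- split parameters -/
  α : V → V → ℝ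
  α_nonneg : ∀ i j, G.Adj i j → 0 ≤ α i j
  α_pos : ∀ i j, G.Adj i j → 0 < α i j + α j i
  /-- edge weights -/
  w : Sym2 V → ℝ
  w_nonneg : ∀ e ∈ G.edgeSet, 0 ≤ w e
  /-- individual preferences -/
  q : V → Fin c → ℝ
  q_nonneg : ∀ i, ∀ a ∈ S i, 0 ≤ q i a

namespace ClusteringGame

variable {V : Type*} {G : SimpleGraph V} {c : ℕ}

/-- All edges are coordination edges. -/
def IsCoordination (Γ : ClusteringGame G c) : Prop := Γ.Ea = ∅

/-- The two endpoints of every edge have the same split parameter. -/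
def IsEqualSplit (Γ : ClusteringGame G c) : Prop := ∀ i j, G.Adj i j → Γ.α i j = Γ.α j i

/-- There are no individual preferences. -/
def NoPreferences (Γ : ClusteringGame G c) : Prop := ∀ i, ∀ a ∈ Γ.S i, Γ.q i a = 0

/-- `s` is a strategy profile: every player chooses one of her available colors. -/
def IsProfile (Γ : ClusteringGame G c) (s : V → Fin c) : Prop := ∀ i, s i ∈ Γ.S i

/-- The edge `{i, j}` is an edge of the graph that is satisfied in `s`. -/
def Satisfied (Γ : ClusteringGame G c) (s : V → Fin c) (i j : V) : Prop :=
  (s(i, j) ∈ Γ.Ec ∧ s i = s j) ∨ (s(i, j) ∈ Γ.Ea ∧ s i ≠ s j)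

open Classical in
/-- The utility `u_i(s)` of player `i`. -/
noncomputable def utility [Fintype V] (Γ : ClusteringGame G c) (s : V → Fin c) (i : V) : ℝ :=
  Γ.q i (s i) +
    ∑ j, if Γ.Satisfied s i j then Γ.α i j / (Γ.α i j + Γ.α j i) * Γ.w s(i, j) else 0

/-- The social welfare `u(s) = ∑ i, u_i(s)`. -/
noncomputable def welfare [Fintype V] (Γ : ClusteringGame G c) (s : V → Fin c) : ℝ :=
  ∑ i, Γ.utility s i

open Classical in
/-- The profile `(s_{-K}, s'_K)`: players in `K` follow `s'`, all others follow `s`. -/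
noncomputable def deviate (K : Finset V) (s s' : V → Fin c) : V → Fin c :=
  fun i => if i ∈ K then s' i else s i

/-- `s` is an `ε`-approximate `k`-strong equilibrium. -/
def IsEquilibrium [Fintype V] (Γ : ClusteringGame G c) (ε : ℝ) (k : ℕ) (s : V → Fin c) : Prop :=
  Γ.IsProfile s ∧
    ∀ K : Finset V, K.Nonempty → K.card ≤ k →
      ∀ s' : V → Fin c, (∀ i ∈ K, s' i ∈ Γ.S i) →
        ∃ j ∈ K, Γ.utility (deviate K s s') j ≤ ε * Γ.utility s j

/-- `t` is a strategy profile of maximum social welfare. -/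
def IsOptimal [Fintype V] (Γ : ClusteringGame G c) (t : V → Fin c) : Prop :=
  Γ.IsProfile t ∧ ∀ t', Γ.IsProfile t' → Γ.welfare t' ≤ Γ.welfare t

open Classical in
/-- The ratio `a / b` of two nonnegative welfare values, with `a / 0 = ∞` for `a > 0` and
`0 / 0 = 1`. -/
noncomputable def welfareRatio (a b : ℝ) : ENNReal :=
  if a = 0 ∧ b = 0 then 1 else ENNReal.ofReal a / ENNReal.ofReal b

/-- The `(ε, k)`-Price of Anarchy of a game: the worst ratio `u(s*) / u(s)` over all
`(ε, k)`-equilibria `s`, where `s*` is a social optimum (a game without `(ε, k)`-equilibria gets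
the value of the empty supremum). -/
noncomputable def poa [Fintype V] (Γ : ClusteringGame G c) (ε : ℝ) (k : ℕ) : ENNReal :=
  ⨆ (s : V → Fin c) (_ : Γ.IsEquilibrium ε k s) (t : V → Fin c) (_ : Γ.IsOptimal t),
    welfareRatio (Γ.welfare t) (Γ.welfare s)

/-- The `(ε, k)`-Price of Anarchy of a class of games. -/
noncomputable def classPoa [Fintype V] (𝒢 : Set (ClusteringGame G c)) (ε : ℝ) (k : ℕ) : ENNReal :=
  ⨆ Γ ∈ 𝒢, Γ.poa ε k

/-- All coordination games on `G` with `c` colors, arbitrary strategy sets, arbitrary weights,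
equal-split distribution rule and no individual preferences. -/
def equalSplitCoordinationGames {V : Type*} (G : SimpleGraph V) (c : ℕ) :
    Set (ClusteringGame G c) :=
  {Γ | Γ.IsCoordination ∧ Γ.IsEqualSplit ∧ Γ.NoPreferences}

end ClusteringGame

/-- The edge probability `d / n` (truncated to `1` for the finitely many `n < d`). -/
noncomputable def sparseProb (d : ℝ) (n : ℕ) : unitInterval :=
  Set.projIcc 0 1 zero_le_one (d / n)

/-!
The price of anarchy of a graph is governed by its maximum degree `Δ`. If `s` is an equilibrium and
`t` a profile, then the endpoints of an edge satisfied in `t` may jointly deviate to `t`, so the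
weight of this edge is at most a multiple of `ε` times the utilities of its endpoints in `s`;
summing over all edges bounds the price of anarchy by `max 1 (2 * ε * Δ)`. Conversely, let the
center of a star of size `Δ` be trapped with one leaf on an edge of weight `1`, while the other
edges of the star have weight `ε / (k - 1)`: a coalition contains at most `k - 1` leaves besides the
center, so the center cannot improve by a factor of more than `ε`, although these `Δ - 1` edges have
total weight `(Δ - 1) * ε / (k - 1)`.

It remains to see that `Δ = Θ(log n / log log n)` with high probability in the random graph with
edge probability `p = Θ(1 / n)`. The upper bound is a first moment bound on the number of `r`-stars.
For the lower bound, split the vertices into two halves: the numbers of neighbors that the vertices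
of one half have in the other half are independent, so some vertex has exactly `r` such neighbors
with high probability as soon as the expected number of these vertices tends to infinity.
-/

/-! ### Price of anarchy and maximum degree -/

section

variable {V : Type*} [Fintype V] (G : SimpleGraph V) [DecidableRel G.Adj]

theorem sum_sum_neighborFinset {R : Type*} [Semiring R] (f : V → R) :
    ∑ i, ∑ j ∈ G.neighborFinset i, f j = ∑ j, G.degree j * f j := by
  rw [Finset.sum_comm' (t' := Finset.univ) (s' := fun j => G.neighborFinset j)
    fun i j => by simp [G.adj_comm]]
  simp

end

namespace ClusteringGame

section Utility

variable {V : Type*} {G : SimpleGraph V} {c : ℕ} {Γ : ClusteringGame G c} {s : V → Fin c} {i j : V}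

theorem half_weight_nonneg (Γ : ClusteringGame G c) (hij : G.Adj i j) : 0 ≤ Γ.w s(i, j) / 2 :=
  div_nonneg (Γ.w_nonneg _ hij) zero_le_two

variable [Fintype V]

theorem utility_eq_sum_neighborFinset [DecidableRel G.Adj]
    (hΓ : Γ ∈ equalSplitCoordinationGames G c) (hi : s i ∈ Γ.S i) :
    Γ.utility s i = ∑ j ∈ G.neighborFinset i with s i = s j, Γ.w s(i, j) / 2 := by
  obtain ⟨hcoord : Γ.Ea = ∅, hsplit, hpref⟩ := hΓ
  have hEc : Γ.Ec = G.edgeSet := by simpa [hcoord] using Γ.union_eq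
  have hsat (j : V) : Γ.Satisfied s i j ↔ G.Adj i j ∧ s i = s j := by
    simp [Satisfied, hEc, hcoord]
  have hhalf (j : V) (hij : G.Adj i j) : Γ.α i j / (Γ.α i j + Γ.α j i) = 1 / 2 := by
    have hα := Γ.α_pos i j hij
    rw [← hsplit i j hij, ← two_mul] at hα ⊢
    have : Γ.α i j ≠ 0 := by linarith
    field_simp
  simp only [utility, hpref i _ hi, zero_add, hsat, ← Finset.sum_filter]
  refine Finset.sum_congr (by ext; simp) fun j hj => ?_
  rw [hhalf j (by simpa using (Finset.mem_filter.1 hj).1), div_mul_eq_mul_div, one_mul]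

theorem utility_nonneg (hΓ : Γ ∈ equalSplitCoordinationGames G c) (hi : s i ∈ Γ.S i) :
    0 ≤ Γ.utility s i := by
  classical
  rw [utility_eq_sum_neighborFinset hΓ hi]
  exact Finset.sum_nonneg fun j hj => Γ.half_weight_nonneg (by simp_all)

theorem half_weight_le_utility (hΓ : Γ ∈ equalSplitCoordinationGames G c) (hi : s i ∈ Γ.S i)
    (hij : G.Adj i j) (hs : s i = s j) : Γ.w s(i, j) / 2 ≤ Γ.utility s i := by
  classical
  rw [utility_eq_sum_neighborFinset hΓ hi]
  exact Finset.single_le_sum (f := fun j => Γ.w s(i, j) / 2)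
    (fun j hj => Γ.half_weight_nonneg (by simp_all)) (by simp [hij, hs])

end Utility

section UpperBound

variable {V : Type*} [Fintype V] {G : SimpleGraph V} {c : ℕ} {Γ : ClusteringGame G c}
  {s t : V → Fin c} {ε : ℝ} {k : ℕ}

/- The pair `{i, j}` may deviate jointly to `t`, so one of its members already receives
`w s(i, j) / (2 * ε)`. -/
theorem IsEquilibrium.half_weight_le (hΓ : Γ ∈ equalSplitCoordinationGames G c) (hε : 0 ≤ ε)
    (hk : 2 ≤ k) (hs : Γ.IsEquilibrium ε k s) (ht : Γ.IsProfile t) {i j : V} (hij : G.Adj i j)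
    (hts : t i = t j) : Γ.w s(i, j) / 2 ≤ ε * (Γ.utility s i + Γ.utility s j) := by
  classical
  have hui := mul_nonneg hε (utility_nonneg hΓ (hs.1 i))
  have huj := mul_nonneg hε (utility_nonneg hΓ (hs.1 j))
  have hdi : deviate {i, j} s t i = t i := by simp [deviate]
  have hdj : deviate {i, j} s t j = t j := by simp [deviate]
  have hgain_i : Γ.w s(i, j) / 2 ≤ Γ.utility (deviate {i, j} s t) i :=
    half_weight_le_utility hΓ (hdi ▸ ht i) hij (by rw [hdi, hdj, hts])
  have hgain_j : Γ.w s(i, j) / 2 ≤ Γ.utility (deviate {i, j} s t) j := by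
    rw [Sym2.eq_swap]
    exact half_weight_le_utility hΓ (hdj ▸ ht j) hij.symm (by rw [hdi, hdj, hts])
  obtain ⟨l, hl, hle⟩ := hs.2 {i, j} (by simp) (Finset.card_le_two.trans hk) t fun l _ => ht l
  rw [mul_add]
  obtain rfl | rfl : l = i ∨ l = j := by simpa using hl
  all_goals linarith

theorem IsEquilibrium.welfare_le [DecidableRel G.Adj] (hΓ : Γ ∈ equalSplitCoordinationGames G c)
    (hε : 0 ≤ ε) (hk : 2 ≤ k) (hs : Γ.IsEquilibrium ε k s) (ht : Γ.IsProfile t) :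
    Γ.welfare t ≤ 2 * ε * G.maxDegree * Γ.welfare s := by
  set u := Γ.utility s
  have hu (i : V) : 0 ≤ u i := utility_nonneg hΓ (hs.1 i)
  calc Γ.welfare t
      = ∑ i, ∑ j ∈ G.neighborFinset i with t i = t j, Γ.w s(i, j) / 2 :=
        Finset.sum_congr rfl fun i _ => utility_eq_sum_neighborFinset hΓ (ht i)
    _ ≤ ∑ i, ∑ j ∈ G.neighborFinset i with t i = t j, ε * (u i + u j) := by
        gcongr with i _ j hj
        obtain ⟨hij, htij⟩ := Finset.mem_filter.1 hj
        exact hs.half_weight_le hΓ hε hk ht (by simpa using hij) htij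
    _ ≤ ∑ i, ∑ j ∈ G.neighborFinset i, ε * (u i + u j) := by
        gcongr with i
        · exact fun j _ _ => mul_nonneg hε (add_nonneg (hu i) (hu j))
        · exact Finset.filter_subset _ _
    _ = 2 * ε * ∑ i, G.degree i * u i := by
        simp_rw [← Finset.mul_sum, Finset.sum_add_distrib, sum_sum_neighborFinset, Finset.sum_const,
          G.card_neighborFinset_eq_degree, nsmul_eq_mul]
        ring
    _ ≤ 2 * ε * ∑ i, G.maxDegree * u i := by
        gcongr with i
        · exact hu i
        · exact G.degree_le_maxDegree i
    _ = 2 * ε * G.maxDegree * Γ.welfare s := by rw [← Finset.mul_sum, ← mul_assoc]; rfl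

theorem welfareRatio_le {a b r : ℝ} (hr : 1 ≤ r) (h : a ≤ r * b) :
    welfareRatio a b ≤ ENNReal.ofReal r := by
  unfold welfareRatio
  split_ifs
  · simpa using hr
  · refine ENNReal.div_le_of_le_mul ?_
    rw [← ENNReal.ofReal_mul (zero_le_one.trans hr)]
    exact ENNReal.ofReal_le_ofReal h

theorem classPoa_le_maxDegree [DecidableRel G.Adj] (hε : 0 ≤ ε) (hk : 2 ≤ k) :
    classPoa (equalSplitCoordinationGames G c) ε k ≤
      ENNReal.ofReal (max 1 (2 * ε * G.maxDegree)) := by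
  refine iSup₂_le fun Γ hΓ => iSup₂_le fun s hs => iSup₂_le fun t ht =>
    welfareRatio_le (le_max_left _ _) ((hs.welfare_le hΓ hε hk ht.1).trans ?_)
  have hs0 : 0 ≤ Γ.welfare s := Finset.sum_nonneg fun i _ => utility_nonneg hΓ (hs.1 i)
  gcongr
  exact le_max_right _ _

end UpperBound

section LowerBound

variable {V : Type*} {G : SimpleGraph V} {c : ℕ} {v l : V} {x : ℝ} {hx : 0 ≤ x} {a : Fin 3 ↪ Fin c}

open Classical in
/-- The coordination game that forces a bad equilibrium on the star with center `v`: the edge from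
`v` to the leaf `l` has weight `1`, the other edges at `v` have weight `x`, and all other edges have
weight `0`. The center chooses between the colors `a 0` and `a 1`, the leaf `l` has to choose `a 0`,
and everybody else chooses between `a 1` and `a 2`. -/
noncomputable def starGame (G : SimpleGraph V) (v l : V) (x : ℝ) (hx : 0 ≤ x) (a : Fin 3 ↪ Fin c) :
    ClusteringGame G c where
  Ec := G.edgeSet
  Ea := ∅
  union_eq := Set.union_empty _
  disjoint := Set.disjoint_empty _
  S i := if i = v then {a 0, a 1} else if i = l then {a 0} else {a 1, a 2}
  S_nonempty i := by split_ifs <;> simp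
  α _ _ := 1
  α_nonneg _ _ _ := zero_le_one
  α_pos _ _ _ := by norm_num
  w e := if e = s(v, l) then 1 else if v ∈ e then x else 0
  w_nonneg e _ := by split_ifs <;> simp [hx]
  q _ _ := 0
  q_nonneg _ _ _ := le_rfl

open Classical in
/-- The profile of `starGame` in which the center is trapped with the leaf `l`: it avoids `a 1`, and
no other leaf shares its color. -/
noncomputable def starTrap (v l : V) (a : Fin 3 ↪ Fin c) (i : V) : Fin c :=
  if i = v ∨ i = l then a 0 else a 2

theorem starGame_mem : starGame G v l x hx a ∈ equalSplitCoordinationGames G c :=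
  ⟨rfl, fun _ _ _ => rfl, fun _ _ _ => rfl⟩

theorem isProfile_starTrap (hvl : v ≠ l) :
    (starGame G v l x hx a).IsProfile (starTrap v l a) := by
  intro i
  by_cases hiv : i = v <;> by_cases hil : i = l <;> simp_all [starGame, starTrap]

theorem IsProfile.deviate {Γ : ClusteringGame G c} {s s' : V → Fin c} {K : Finset V}
    (hs : Γ.IsProfile s) (hs' : ∀ i ∈ K, s' i ∈ Γ.S i) : Γ.IsProfile (deviate K s s') := by
  intro i
  unfold ClusteringGame.deviate
  split_ifs with hi
  exacts [hs' i hi, hs i]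

theorem starGame_weight_center [DecidableEq V] (j : V) :
    (starGame G v l x hx a).w s(v, j) = if j = l then 1 else x := by
  simp only [starGame, Sym2.congr_right, Sym2.mem_mk_left, if_true]

variable [Fintype V] {y : V → Fin c}

theorem starGame_utility_center [DecidableEq V] [DecidableRel G.Adj]
    (hy : (starGame G v l x hx a).IsProfile y) :
    (starGame G v l x hx a).utility y v =
      ∑ j ∈ G.neighborFinset v with y v = y j, (if j = l then 1 else x) / 2 := by
  rw [utility_eq_sum_neighborFinset starGame_mem (hy v)]
  simp_rw [starGame_weight_center]

theorem starGame_utility_leaf [DecidableEq V] [DecidableRel G.Adj]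
    (hy : (starGame G v l x hx a).IsProfile y) {i : V} (hi : i ≠ v) :
    (starGame G v l x hx a).utility y i =
      if G.Adj v i ∧ y v = y i then (if i = l then 1 else x) / 2 else 0 := by
  have hweight (j : V) (hj : j ≠ v) : (starGame G v l x hx a).w s(i, j) / 2 = 0 := by
    simp [starGame, hi, hj, hi.symm, hj.symm]
  rw [utility_eq_sum_neighborFinset starGame_mem (hy i)]
  by_cases h : G.Adj v i ∧ y v = y i
  · rw [if_pos h, Finset.sum_eq_single_of_mem v (by simp [h.1.symm, h.2]) fun j _ => hweight j,
      Sym2.eq_swap, starGame_weight_center]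
  · rw [if_neg h]
    refine Finset.sum_eq_zero fun j hj => hweight j ?_
    rintro rfl
    exact h (by simpa [G.adj_comm, eq_comm] using hj)

theorem starGame_welfare (hy : (starGame G v l x hx a).IsProfile y) :
    (starGame G v l x hx a).welfare y = 2 * (starGame G v l x hx a).utility y v := by
  classical
  rw [welfare, ← Finset.add_sum_erase _ _ (Finset.mem_univ v), two_mul, add_right_inj,
    Finset.sum_congr rfl fun i hi => starGame_utility_leaf hy (Finset.ne_of_mem_erase hi),
    starGame_utility_center hy, ← Finset.sum_filter]
  refine Finset.sum_congr ?_ fun _ _ => rfl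
  ext i
  simp only [Finset.mem_filter, Finset.mem_erase, Finset.mem_univ, and_true,
    G.mem_neighborFinset]
  exact and_iff_right_of_imp fun h => h.1.ne'

theorem starGame_utility_leaf_of_center_eq_zero [DecidableEq V]
    (hy : (starGame G v l x hx a).IsProfile y) (hvl : G.Adj v l) (hyv : y v = a 0) {i : V}
    (hi : i ≠ v) : (starGame G v l x hx a).utility y i = if i = l then 1 / 2 else 0 := by
  classical
  have hyi := hy i
  rw [starGame_utility_leaf hy hi, hyv]
  by_cases hil : i = l
  · simp_all [starGame]
  · have : a 0 ≠ y i := by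
      rintro h
      simp [starGame, hi, hil, ← h] at hyi
    simp [this, hil]

theorem starGame_utility_center_of_eq_zero (hy : (starGame G v l x hx a).IsProfile y)
    (hvl : G.Adj v l) (hyv : y v = a 0) : (starGame G v l x hx a).utility y v = 1 / 2 := by
  classical
  have hwelfare := starGame_welfare hy
  rw [welfare, ← Finset.add_sum_erase _ _ (Finset.mem_univ v), two_mul, add_right_inj,
    Finset.sum_congr rfl fun i hi =>
      starGame_utility_leaf_of_center_eq_zero hy hvl hyv (Finset.ne_of_mem_erase hi)] at hwelfare
  simpa [hvl.ne'] using hwelfare.symm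

theorem starGame_utility_center_of_eq_one [DecidableRel G.Adj]
    (hy : (starGame G v l x hx a).IsProfile y) (hvl : v ≠ l) (hyv : y v = a 1) :
    (starGame G v l x hx a).utility y v = {j ∈ G.neighborFinset v | y j = a 1}.card * (x / 2) := by
  classical
  have hyl : y l = a 0 := by simpa [starGame, hvl.symm] using hy l
  simp_rw [starGame_utility_center hy, hyv, eq_comm (a := a 1), ← nsmul_eq_mul, ← Finset.sum_const]
  refine Finset.sum_congr rfl fun j hj => ?_
  have hjl : j ≠ l := by
    rintro rfl
    simp [hyl] at hj
  rw [if_neg hjl]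

theorem isEquilibrium_starTrap {ε : ℝ} (hε : 1 ≤ ε) {k : ℕ} (hxk : (k - 1) * x ≤ ε)
    (hvl : G.Adj v l) : (starGame G v l x hx a).IsEquilibrium ε k (starTrap v l a) := by
  classical
  have htrap : (starGame G v l x hx a).IsProfile (starTrap v l a) := isProfile_starTrap hvl.ne
  have htrap_center : starTrap v l a v = a 0 := by simp [starTrap]
  refine ⟨htrap, fun K hK hKk s' hs' => ?_⟩
  have hy := htrap.deviate hs'
  set y := deviate K (starTrap v l a) s' with hy_def
  by_cases hvK : v ∈ K
  · refine ⟨v, hvK, ?_⟩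
    rw [starGame_utility_center_of_eq_zero htrap hvl htrap_center]
    obtain hyv | hyv : y v = a 0 ∨ y v = a 1 := by simpa [starGame] using hy v
    · rw [starGame_utility_center_of_eq_zero hy hvl hyv]
      linarith
    · have hsub : {j ∈ G.neighborFinset v | y j = a 1} ⊆ K.erase v := by
        intro j hj
        obtain ⟨hj, hyj⟩ := Finset.mem_filter.1 hj
        refine Finset.mem_erase.2 ⟨by rintro rfl; simp at hj, ?_⟩
        by_contra hjK
        rw [hy_def, deviate, if_neg hjK, starTrap] at hyj
        split_ifs at hyj <;> simp at hyj
      have hcard : ({j ∈ G.neighborFinset v | y j = a 1}.card : ℝ) ≤ k - 1 := by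
        have := (Finset.card_le_card hsub).trans_lt (Finset.card_erase_lt_of_mem hvK)
        rw [le_sub_iff_add_le]
        exact_mod_cast this.trans_le hKk
      rw [starGame_utility_center_of_eq_one hy hvl.ne hyv]
      linarith [mul_le_mul_of_nonneg_right hcard hx]
  · obtain ⟨j, hj⟩ := hK
    have hjv : j ≠ v := fun h => hvK (h ▸ hj)
    have hyv : y v = a 0 := by rw [hy_def, deviate, if_neg hvK, htrap_center]
    refine ⟨j, hj, le_of_eq_of_le ?_
      (le_mul_of_one_le_left (utility_nonneg starGame_mem (htrap j)) hε)⟩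
    rw [starGame_utility_leaf_of_center_eq_zero hy hvl hyv hjv,
      starGame_utility_leaf_of_center_eq_zero htrap hvl htrap_center hjv]

theorem exists_isOptimal (Γ : ClusteringGame G c) : ∃ t, Γ.IsOptimal t :=
  Set.exists_max_image {t | Γ.IsProfile t} Γ.welfare (Set.toFinite _)
    ⟨fun i => (Γ.S_nonempty i).some, fun i => (Γ.S_nonempty i).some_mem⟩

theorem ofReal_le_welfareRatio {b r : ℝ} (hb : b ≤ 1) :
    ENNReal.ofReal r ≤ welfareRatio r b := by
  unfold welfareRatio
  split_ifs with h0
  · simp [h0.1]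
  · simpa using ENNReal.div_le_div_left (ENNReal.ofReal_le_one.2 hb) (ENNReal.ofReal r)

theorem ofReal_welfare_le_classPoa {𝒢 : Set (ClusteringGame G c)} {Γ : ClusteringGame G c}
    (hΓ : Γ ∈ 𝒢) {ε : ℝ} {k : ℕ} {s t : V → Fin c} (hs : Γ.IsEquilibrium ε k s)
    (hs_le : Γ.welfare s ≤ 1) (ht : Γ.IsProfile t) :
    ENNReal.ofReal (Γ.welfare t) ≤ classPoa 𝒢 ε k := by
  obtain ⟨t', ht'⟩ := Γ.exists_isOptimal
  calc ENNReal.ofReal (Γ.welfare t)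
      ≤ ENNReal.ofReal (Γ.welfare t') := ENNReal.ofReal_le_ofReal (ht'.2 t ht)
    _ ≤ welfareRatio (Γ.welfare t') (Γ.welfare s) := ofReal_le_welfareRatio hs_le
    _ ≤ Γ.poa ε k := le_iSup₂_of_le s hs (le_iSup₂_of_le t' ht' le_rfl)
    _ ≤ classPoa 𝒢 ε k := le_iSup₂_of_le Γ hΓ le_rfl

theorem degree_le_classPoa [DecidableRel G.Adj] (hc : 3 ≤ c) {ε : ℝ} (hε : 1 ≤ ε) {k : ℕ}
    (hx : 0 ≤ x) (hxk : (k - 1) * x ≤ ε) (v : V) :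
    ENNReal.ofReal ((G.degree v - 1) * x) ≤ classPoa (equalSplitCoordinationGames G c) ε k := by
  classical
  obtain hdeg | hdeg := (G.degree v).eq_zero_or_pos
  · simp [hdeg, ENNReal.ofReal_of_nonpos (neg_nonpos.2 hx)]
  obtain ⟨l, hvl⟩ := (G.degree_pos_iff_exists_adj v).1 hdeg
  let a : Fin 3 ↪ Fin c := Fin.castLEEmb hc
  let Γ := starGame G v l x hx a
  have htrap : Γ.IsEquilibrium ε k (starTrap v l a) := isEquilibrium_starTrap hε hxk hvl
  have htrap_welfare : Γ.welfare (starTrap v l a) = 1 := by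
    rw [starGame_welfare htrap.1,
      starGame_utility_center_of_eq_zero htrap.1 hvl (by simp [starTrap]),
      mul_one_div_cancel two_ne_zero]
  let t (i : V) : Fin c := if i = l then a 0 else a 1
  have ht : Γ.IsProfile t := by
    intro i
    by_cases hiv : i = v <;> by_cases hil : i = l <;> simp_all [Γ, starGame, t]
  have hmatched : {j ∈ G.neighborFinset v | t j = a 1} = (G.neighborFinset v).erase l := by
    ext j
    by_cases hjl : j = l <;> simp [t, hjl]
  have ht_welfare : Γ.welfare t = (G.degree v - 1) * x := by
    rw [starGame_welfare ht, starGame_utility_center_of_eq_one ht hvl.ne (by simp [t, hvl.ne]),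
      hmatched, Finset.card_erase_of_mem (by simpa using hvl), G.card_neighborFinset_eq_degree,
      Nat.cast_pred hdeg]
    ring
  rw [← ht_welfare]
  exact ofReal_welfare_le_classPoa starGame_mem htrap htrap_welfare.le ht

theorem maxDegree_le_classPoa [DecidableRel G.Adj] (hc : 3 ≤ c) {ε : ℝ} (hε : 1 ≤ ε) {k : ℕ}
    (hx : 0 ≤ x) (hxk : (k - 1) * x ≤ ε) :
    ENNReal.ofReal ((G.maxDegree - 1) * x) ≤ classPoa (equalSplitCoordinationGames G c) ε k := by
  cases isEmpty_or_nonempty V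
  · simp [ENNReal.ofReal_of_nonpos (neg_nonpos.2 hx)]
  · obtain ⟨v, hv⟩ := G.exists_maximal_degree_vertex
    exact hv ▸ degree_le_classPoa hc hε hx hxk v

end LowerBound

open Classical in
theorem classPoa_mem_Icc_of_maxDegree {V : Type*} [Fintype V]
    {G : SimpleGraph V} {c k : ℕ} (hc : 3 ≤ c) (hk : 2 ≤ k) {ε x : ℝ} (hε : 1 ≤ ε) (hx : 8 ≤ x)
    (hlow : ⌊x / 2⌋₊ ≤ G.maxDegree) (hup : ∀ v, G.degree v ≤ 4 * x) :
    classPoa (equalSplitCoordinationGames G c) ε k ∈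
      Set.Icc (ENNReal.ofReal (1 / (4 * (k - 1)) * (ε * x))) (ENNReal.ofReal (8 * (ε * x))) := by
  have hk1 : (0 : ℝ) < k - 1 := sub_pos.2 (by exact_mod_cast hk)
  have hε0 : 0 < ε := zero_lt_one.trans_le hε
  constructor
  · have hlow : x / 2 < G.maxDegree + 1 :=
      (Nat.lt_floor_add_one _).trans_le (by exact_mod_cast Nat.succ_le_succ hlow)
    refine le_trans (ENNReal.ofReal_le_ofReal ?_) (maxDegree_le_classPoa hc hε
      (x := ε / (k - 1)) (by positivity) (mul_div_cancel₀ _ hk1.ne').le)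
    calc 1 / (4 * (k - 1)) * (ε * x) = x / 4 * (ε / (k - 1)) := by field_simp
      _ ≤ (G.maxDegree - 1) * (ε / (k - 1)) := by
        gcongr
        linarith
  · have hup : (G.maxDegree : ℝ) ≤ 4 * x :=
      (Nat.le_floor_iff (by positivity)).1
        (G.maxDegree_le_of_forall_degree_le _ fun v => Nat.le_floor (hup v))
    refine (classPoa_le_maxDegree hε0.le hk).trans (ENNReal.ofReal_le_ofReal (max_le ?_ ?_))
    · nlinarith
    · nlinarith

end ClusteringGame

/-! ### Degrees in binomial random graphs -/

section RandomGraph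

open MeasureTheory Measure ProbabilityTheory unitInterval

@[fun_prop]
theorem measurable_set_preimage {α ι : Type*} (f : α → ι) : Measurable (Set.preimage f) :=
  measurable_set_iff.2 fun a => measurable_set_mem (f a)

theorem setBernoulli_map_preimage {α ι : Type*} {u : Set ι} {p : I} {f : α → ι}
    (hf : Function.Injective f) : setBer(u, p).map (f ⁻¹' ·) = setBer(f ⁻¹' u, p) := by
  have hlaw := map_infinitePi_infinitePi_of_inj hf
    (P := fun i => toNNReal p • dirac (i ∈ u) + toNNReal (σ p) • dirac False)
  rw [setBernoulli_eq_map, setBernoulli_eq_map, Measure.map_map (by fun_prop) (by fun_prop)]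
  simp only [Set.mem_preimage]
  rw [← hlaw, Measure.map_map (by fun_prop) (by fun_prop)]
  rfl

theorem setBernoulli_real_ncard_eq {β : Type*} [Finite β] {p : I} (r : ℕ) :
    setBer(Set.univ, p).real {S : Set β | S.ncard = r} =
      (Nat.card β).choose r * (p : ℝ) ^ r * (1 - p) ^ (Nat.card β - r) := by
  rw [← Set.ncard_univ, ← map_ncard_setBernoulli_real_singleton Set.finite_univ,
    map_measureReal_apply (by fun_prop) .of_discrete]
  rfl

theorem setBernoulli_forall_preimage_mk_mem {α β : Type*} [Finite α] {p : I} {E : Set (Set β)}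
    (hE : MeasurableSet E) :
    setBer(Set.univ, p) {S : Set (α × β) | ∀ a, Prod.mk a ⁻¹' S ∈ E} =
      setBer(Set.univ, p) E ^ Nat.card α := by
  cases nonempty_fintype α
  have hF : MeasurableSet ((fun q : β → Prop => {b | q b}) ⁻¹' E) :=
    MeasurableEquiv.setOfPred.measurable hE
  have hrows : (fun q : α × β → Prop => {x | q x}) ⁻¹' {S | ∀ a, Prod.mk a ⁻¹' S ∈ E} =
      MeasurableEquiv.curry α β Prop ⁻¹'
        Set.univ.pi fun _ => (fun q : β → Prop => {b | q b}) ⁻¹' E := by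
    ext q
    simp [Set.mem_pi]
  rw [setBernoulli_apply', setBernoulli_apply', hrows,
    ← map_apply (MeasurableEquiv.measurable _) (.univ_pi fun _ => hF)]
  simp only [Set.mem_univ]
  rw [infinitePi_map_curry fun _ _ => toNNReal p • dirac True + toNNReal (σ p) • dirac False,
    infinitePi_pi_univ _ fun _ => hF, tprod_fintype, Finset.prod_const, Finset.card_univ,
    Nat.card_eq_fintype_card]

variable {V : Type*} {p : I}

theorem binomialRandom_map_preimage_edgeSet [Countable V] {α : Type*} {f : α → Sym2 V}
    (hf : Function.Injective f) (hdiag : ∀ a, ¬ (f a).IsDiag) :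
    (SimpleGraph.binomialRandom V p).map (fun G => f ⁻¹' G.edgeSet) = setBer(Set.univ, p) := by
  have hpre : f ⁻¹' Sym2.diagSetᶜ = Set.univ := Set.eq_univ_of_forall hdiag
  rw [SimpleGraph.binomialRandom_eq_map, ← hpre,
    Measure.map_map (by fun_prop) (by fun_prop),
    ← setBernoulli_map_preimage hf]
  congr 1
  funext S
  ext a
  simpa using fun _ => hdiag a

theorem binomialRandom_real_forall_adj_le [Finite V] (v : V) (T : Finset V) :
    (SimpleGraph.binomialRandom V p).real {G | ∀ j ∈ T, G.Adj v j} ≤ (p : ℝ) ^ T.card := by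
  by_cases hv : v ∈ T
  · have hempty : {G : SimpleGraph V | ∀ j ∈ T, G.Adj v j} = ∅ :=
      Set.eq_empty_of_forall_notMem fun G hG => G.irrefl (hG v hv)
    simpa [hempty] using pow_nonneg p.2.1 _
  · let f (j : T) : Sym2 V := s(v, j)
    have hf : Function.Injective f := fun i j h => Subtype.ext (Sym2.congr_right.1 h)
    have hdiag (j : T) : ¬ (f j).IsDiag := fun h => hv (Sym2.mk_isDiag_iff.1 h ▸ j.2)
    have hpre : {G : SimpleGraph V | ∀ j ∈ T, G.Adj v j} = (f ⁻¹' ·.edgeSet) ⁻¹' {Set.univ} := by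
      ext G
      simp [Set.eq_univ_iff_forall, f]
    rw [hpre, ← map_measureReal_apply (by fun_prop) (Set.toFinite _).measurableSet,
      binomialRandom_map_preimage_edgeSet hf hdiag,
      setBernoulli_real_singleton p subset_rfl Set.finite_univ]
    simp [Set.ncard_univ]

open Classical in
theorem binomialRandom_real_le_degree_le [Fintype V] (v : V) (r : ℕ) :
    (SimpleGraph.binomialRandom V p).real {G | r ≤ G.degree v} ≤
      (Fintype.card V).choose r * (p : ℝ) ^ r := by
  have hsub : {G : SimpleGraph V | r ≤ G.degree v} ⊆
      ⋃ T ∈ (Finset.univ : Finset V).powersetCard r, {G | ∀ j ∈ T, G.Adj v j} := by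
    intro G hG
    obtain ⟨T, hT, hcard⟩ := Finset.exists_subset_card_eq (hG : r ≤ (G.neighborFinset v).card)
    simp only [Set.mem_iUnion]
    exact ⟨T, by simp [hcard], fun j hj => by simpa using hT hj⟩
  calc _ ≤ _ := measureReal_mono hsub (measure_ne_top _ _)
    _ ≤ _ := measureReal_biUnion_finset_le _ _
    _ ≤ ∑ _T ∈ (Finset.univ : Finset V).powersetCard r, (p : ℝ) ^ r := by
        gcongr with _ hT
        exact (Finset.mem_powersetCard.1 hT).2 ▸ binomialRandom_real_forall_adj_le v _
    _ = _ := by simp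

open Classical in
theorem binomialRandom_real_exists_le_degree_le [Fintype V] (r : ℕ) :
    (SimpleGraph.binomialRandom V p).real {G | ∃ v, r ≤ G.degree v} ≤
      Fintype.card V * ((Fintype.card V).choose r * (p : ℝ) ^ r) := by
  have hunion : {G : SimpleGraph V | ∃ v, r ≤ G.degree v} =
      ⋃ v ∈ (Finset.univ : Finset V), {G | r ≤ G.degree v} := by
    ext G
    simp
  calc _ ≤ ∑ v, (SimpleGraph.binomialRandom V p).real {G | r ≤ G.degree v} :=
        hunion ▸ measureReal_biUnion_finset_le _ _
    _ ≤ ∑ _v : V, (Fintype.card V).choose r * (p : ℝ) ^ r := by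
        gcongr with v
        exact binomialRandom_real_le_degree_le v r
    _ = _ := by simp

open Classical in
theorem binomialRandom_real_forall_card_ne [Finite V] {A B : Finset V} (hAB : Disjoint A B)
    (r : ℕ) :
    (SimpleGraph.binomialRandom V p).real {G | ∀ a ∈ A, {b ∈ B | G.Adj a b}.card ≠ r} =
      (1 - B.card.choose r * (p : ℝ) ^ r * (1 - p) ^ (B.card - r)) ^ A.card := by
  let f (x : A × B) : Sym2 V := s(x.1, x.2)
  have hne (a : A) (b : B) : (a : V) ≠ b := fun h =>
    Finset.disjoint_left.1 hAB a.2 (h ▸ b.2)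
  have hf : Function.Injective f := by
    intro x y h
    rcases Sym2.eq_iff.1 h with h | h
    · exact Prod.ext (Subtype.ext h.1) (Subtype.ext h.2)
    · exact absurd h.1 (hne _ _)
  have hdiag (x : A × B) : ¬ (f x).IsDiag := fun h => hne _ _ (Sym2.mk_isDiag_iff.1 h)
  let E : Set (Set B) := {S | S.ncard = r}
  have hE : MeasurableSet E := (Set.toFinite E).measurableSet
  have hcard (G : SimpleGraph V) (a : A) :
      {b ∈ B | G.Adj a b}.card = (Prod.mk a ⁻¹' (f ⁻¹' G.edgeSet)).ncard := by
    rw [← Set.ncard_image_of_injective _ Subtype.val_injective, ← Set.ncard_coe_finset]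
    congr 1
    ext b
    simp [f, and_comm]
  have hpre : {G : SimpleGraph V | ∀ a ∈ A, {b ∈ B | G.Adj a b}.card ≠ r} =
      (f ⁻¹' ·.edgeSet) ⁻¹' {S | ∀ a, Prod.mk a ⁻¹' S ∈ Eᶜ} := by
    ext G
    simp [E, ← hcard]
  rw [hpre, ← map_measureReal_apply (by fun_prop) (Set.toFinite _).measurableSet,
    binomialRandom_map_preimage_edgeSet hf hdiag, measureReal_def,
    setBernoulli_forall_preimage_mk_mem hE.compl, ENNReal.toReal_pow, ← measureReal_def,
    probReal_compl_eq_one_sub hE,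
    setBernoulli_real_ncard_eq, Nat.card_eq_finsetCard, Nat.card_eq_finsetCard]

open Classical in
theorem binomialRandom_real_maxDegree_lt_le [Fintype V] {A B : Finset V} (hAB : Disjoint A B)
    (r : ℕ) :
    (SimpleGraph.binomialRandom V p).real {G | G.maxDegree < r} ≤
      Real.exp (-(A.card * (B.card.choose r * (p : ℝ) ^ r * (1 - p) ^ (B.card - r)))) := by
  set q := B.card.choose r * (p : ℝ) ^ r * (1 - p) ^ (B.card - r)
  have hq : q ≤ 1 := by
    have hprob := setBernoulli_real_ncard_eq (β := B) (p := p) r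
    rw [Nat.card_eq_finsetCard] at hprob
    exact hprob.symm.trans_le measureReal_le_one
  calc (SimpleGraph.binomialRandom V p).real {G | G.maxDegree < r}
      ≤ (SimpleGraph.binomialRandom V p).real {G | ∀ a ∈ A, {b ∈ B | G.Adj a b}.card ≠ r} := by
        refine measureReal_mono fun G hG a _ => (LE.le.trans_lt ?_ hG).ne
        exact (Finset.card_le_card fun b => by simp).trans (G.degree_le_maxDegree a)
    _ = (1 - q) ^ A.card := binomialRandom_real_forall_card_ne hAB r
    _ ≤ Real.exp (-q) ^ A.card := pow_le_pow_left₀ (sub_nonneg.2 hq) (Real.one_sub_le_exp_neg q) _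
    _ = Real.exp (-(A.card * q)) := by rw [← Real.exp_nat_mul, mul_neg]

end RandomGraph

/-! ### Estimates for `n * p = Θ(1)` -/

section Estimates

theorem choose_mul_pow_le_pow_div_factorial {n : ℕ} {p b : ℝ} (hp : 0 ≤ p) (hpb : n * p ≤ b)
    (r : ℕ) : n.choose r * p ^ r ≤ b ^ r / r.factorial :=
  calc n.choose r * p ^ r ≤ n ^ r / r.factorial * p ^ r := by
        gcongr
        exact Nat.choose_le_pow_div r n
    _ = (n * p) ^ r / r.factorial := by rw [mul_pow, div_mul_eq_mul_div]
    _ ≤ b ^ r / r.factorial := by gcongr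

theorem pow_div_factorial_le_exp_mul_sqrt_sub {b x : ℝ} (hb : 0 ≤ b) (hx : 1 < x) {r : ℕ}
    (hr : 4 * (x / Real.log x) ≤ r) :
    b ^ r / r.factorial ≤ Real.exp (b * √x - 2 * x) := by
  have hx0 : 0 < x := zero_lt_one.trans hx
  have hlog : 2 * x ≤ r * (Real.log x / 2) := by
    rw [← mul_div_assoc, div_le_iff₀ (Real.log_pos hx)] at hr
    linarith
  have hsqrt : Real.exp (2 * x) ≤ √x ^ r := by
    rw [← Real.exp_log (Real.sqrt_pos.2 hx0), ← Real.exp_nat_mul, Real.log_sqrt hx0.le]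
    exact Real.exp_le_exp.2 hlog
  rw [Real.exp_sub, le_div_iff₀ (Real.exp_pos _)]
  calc b ^ r / r.factorial * Real.exp (2 * x) ≤ b ^ r / r.factorial * √x ^ r := by gcongr
    _ = (b * √x) ^ r / r.factorial := by rw [mul_pow, div_mul_eq_mul_div]
    _ ≤ Real.exp (b * √x) := Real.pow_div_factorial_le_exp _ (by positivity) r

theorem tendsto_exp_mul_sqrt_sub (b : ℝ) :
    Tendsto (fun x : ℝ => Real.exp (b * √x - x)) atTop (𝓝 0) := by
  have hfactor : Tendsto (fun x : ℝ => √x * (√x - b)) atTop atTop :=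
    Real.tendsto_sqrt_atTop.atTop_mul_atTop₀
      (tendsto_atTop_add_const_right _ (-b) Real.tendsto_sqrt_atTop)
  refine Real.tendsto_exp_atBot.comp ((tendsto_neg_atTop_atBot.comp hfactor).congr' ?_)
  filter_upwards [eventually_ge_atTop 0] with x hx
  simp only [Function.comp_apply]
  linarith [Real.mul_self_sqrt hx]

theorem exp_neg_two_mul_le_one_sub {x : ℝ} (hx0 : 0 ≤ x) (hx : x ≤ 1 / 2) :
    Real.exp (-(2 * x)) ≤ 1 - x := by
  have hpos : 0 < 1 - x := by linarith
  rw [Real.exp_neg, inv_le_comm₀ (Real.exp_pos _) hpos]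
  refine le_trans ?_ (Real.add_one_le_exp _)
  rw [inv_le_iff_one_le_mul₀ hpos]
  nlinarith

theorem exp_neg_two_mul_le_one_sub_pow {n j : ℕ} {p b : ℝ} (hp0 : 0 ≤ p) (hp : p ≤ 1 / 2)
    (hpb : n * p ≤ b) (hj : j ≤ n) : Real.exp (-(2 * b)) ≤ (1 - p) ^ j :=
  calc Real.exp (-(2 * b)) ≤ Real.exp (-(2 * (j * p))) := by
        gcongr
        exact (by gcongr : (j : ℝ) * p ≤ n * p).trans hpb
    _ = Real.exp (-(2 * p)) ^ j := by rw [← Real.exp_nat_mul]; ring_nf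
    _ ≤ (1 - p) ^ j := by
        gcongr
        exact exp_neg_two_mul_le_one_sub hp0 hp

theorem factorial_le_exp_half {x : ℝ} (hx : 1 ≤ Real.log x) {r : ℕ}
    (hr : r * Real.log x ≤ x / 2) : (r.factorial : ℝ) ≤ Real.exp (x / 2) := by
  have hr_log : (r : ℝ) ≤ r * Real.log x := le_mul_of_one_le_right r.cast_nonneg hx
  have hr0 : (0 : ℝ) ≤ r := r.cast_nonneg
  have hx0 : 0 < x := by
    have hne : x ≠ 0 := by
      rintro rfl
      norm_num at hx
    exact hne.symm.lt_of_le (by linarith)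
  calc (r.factorial : ℝ) ≤ (r : ℝ) ^ r := by exact_mod_cast r.factorial_le_pow
    _ ≤ x ^ r := pow_le_pow_left₀ hr0 (by linarith) r
    _ = Real.exp (r * Real.log x) := by rw [Real.exp_nat_mul, Real.exp_log hx0]
    _ ≤ Real.exp (x / 2) := Real.exp_le_exp.2 hr

theorem exp_neg_quarter_le_pow {a x : ℝ} (ha : 0 < a) (hax : 2 * |Real.log a| ≤ Real.log x) {r : ℕ}
    (hr : r * Real.log x ≤ x / 2) : Real.exp (-(x / 4)) ≤ a ^ r := by
  rw [← Real.exp_log ha, ← Real.exp_nat_mul, Real.exp_le_exp]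
  have hlog := mul_le_mul_of_nonneg_left hax r.cast_nonneg
  have hneg := mul_le_mul_of_nonneg_left (neg_abs_le (Real.log a)) r.cast_nonneg
  linarith

theorem exp_neg_le_choose_mul_pow {m r : ℕ} {p a x : ℝ} (hp : 0 ≤ p) (ha : 0 < a)
    (hap : a ≤ (m + 1 - r : ℕ) * p) (hx : 1 ≤ Real.log x) (hax : 2 * |Real.log a| ≤ Real.log x)
    (hr : r * Real.log x ≤ x / 2) : Real.exp (-(3 / 4 * x)) ≤ m.choose r * p ^ r :=
  calc Real.exp (-(3 / 4 * x)) = Real.exp (-(x / 4)) / Real.exp (x / 2) := by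
        rw [← Real.exp_sub]
        ring_nf
    _ ≤ a ^ r / r.factorial := by
        gcongr
        · exact exp_neg_quarter_le_pow ha hax hr
        · exact factorial_le_exp_half hx hr
    _ ≤ ((m + 1 - r : ℕ) * p) ^ r / r.factorial := by gcongr
    _ = ((m + 1 - r : ℕ) : ℝ) ^ r / r.factorial * p ^ r := by rw [mul_pow, div_mul_eq_mul_div]
    _ ≤ m.choose r * p ^ r := by
        gcongr
        exact Nat.pow_le_choose r m

theorem exp_quarter_mul_le_half_mul_choose_mul {n r : ℕ} {p a b : ℝ} (hn : 2 ≤ n) (hrn : 4 * r ≤ n)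
    (ha : 0 < a) (hp : 0 ≤ p) (hp2 : p ≤ 1 / 2) (hap : a ≤ n * p) (hpb : n * p ≤ b)
    (hlog : 1 ≤ Real.log (Real.log n)) (hax : 2 * |Real.log (a / 4)| ≤ Real.log (Real.log n))
    (hr : r * Real.log (Real.log n) ≤ Real.log n / 2) :
    Real.exp (Real.log n / 4) * (Real.exp (-(2 * b)) / 4) ≤
      (n / 2 : ℕ) * ((n - n / 2).choose r * p ^ r * (1 - p) ^ (n - n / 2 - r)) := by
  have hhalf : (n : ℝ) / 4 ≤ (n / 2 : ℕ) := by
    rw [div_le_iff₀ (by norm_num)]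
    exact_mod_cast (by lia : n ≤ n / 2 * 4)
  have hquarter : a / 4 ≤ (n - n / 2 + 1 - r : ℕ) * p :=
    calc a / 4 ≤ n / 4 * p := by linarith
      _ ≤ (n - n / 2 + 1 - r : ℕ) * p := by
        gcongr
        rw [div_le_iff₀ (by norm_num)]
        exact_mod_cast (by lia : n ≤ (n - n / 2 + 1 - r) * 4)
  calc Real.exp (Real.log n / 4) * (Real.exp (-(2 * b)) / 4)
      = Real.exp (Real.log n) / 4 *
          (Real.exp (-(3 / 4 * Real.log n)) * Real.exp (-(2 * b))) := by
        rw [show Real.log n / 4 = Real.log n + -(3 / 4 * Real.log n) by ring, Real.exp_add]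
        ring
    _ ≤ (n / 2 : ℕ) * ((n - n / 2).choose r * p ^ r * (1 - p) ^ (n - n / 2 - r)) := by
        rw [Real.exp_log (by positivity)]
        gcongr
        · exact exp_neg_le_choose_mul_pow hp (by positivity) hquarter hlog hax hr
        · exact exp_neg_two_mul_le_one_sub_pow hp hp2 hpb (by lia)

theorem tendsto_log_natCast_atTop : Tendsto (fun n : ℕ => Real.log n) atTop atTop :=
  Real.tendsto_log_atTop.comp tendsto_natCast_atTop_atTop

theorem tendsto_log_log_natCast_atTop : Tendsto (fun n : ℕ => Real.log (Real.log n)) atTop atTop :=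
  Real.tendsto_log_atTop.comp tendsto_log_natCast_atTop

theorem tendsto_div_log_atTop : Tendsto (fun x : ℝ => x / Real.log x) atTop atTop := by
  have hlog_div : Tendsto (fun x : ℝ => Real.log x / x) atTop (𝓝[>] 0) := by
    refine tendsto_nhdsWithin_iff.2 ⟨Real.isLittleO_log_id_atTop.tendsto_div_nhds_zero, ?_⟩
    filter_upwards [eventually_gt_atTop 1] with x hx
    exact div_pos (Real.log_pos hx) (zero_lt_one.trans hx)
  simpa only [Function.comp_def, inv_div] using tendsto_inv_nhdsGT_zero.comp hlog_div

theorem eventually_floor_half_log_div_log_log_le :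
    ∀ᶠ n : ℕ in atTop, 4 * ⌊Real.log n / Real.log (Real.log n) / 2⌋₊ ≤ n ∧
      ⌊Real.log n / Real.log (Real.log n) / 2⌋₊ * Real.log (Real.log n) ≤ Real.log n / 2 := by
  filter_upwards [tendsto_log_natCast_atTop.eventually_gt_atTop 0,
    tendsto_log_log_natCast_atTop.eventually_ge_atTop 1,
    tendsto_natCast_atTop_atTop.eventually (Real.isLittleO_log_id_atTop.bound one_half_pos)]
    with n hlog hloglog hle
  have hle : Real.log n ≤ 1 / 2 * n := by simpa [abs_of_pos hlog] using hle
  set r := ⌊Real.log n / Real.log (Real.log n) / 2⌋₊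
  have hr : (r : ℝ) * Real.log (Real.log n) ≤ Real.log n / 2 := by
    rw [← le_div_iff₀ (by linarith), div_right_comm]
    exact Nat.floor_le (by positivity)
  have hr4 : (4 : ℝ) * r ≤ n := by
    linarith [le_mul_of_one_le_right (r.cast_nonneg : (0 : ℝ) ≤ r) hloglog]
  exact ⟨by exact_mod_cast hr4, hr⟩

end Estimates

/-! ### The maximum degree with high probability -/

section WithHighProbability

open MeasureTheory

section

variable {ι : Type*} {l : Filter ι} {Ω : ι → Type*} [∀ i, MeasurableSpace (Ω i)]
  {μ : ∀ i, Measure (Ω i)} [∀ i, IsProbabilityMeasure (μ i)] {E F : ∀ i, Set (Ω i)}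

theorem tendsto_measure_one_of_compl (h : Tendsto (fun i => (μ i).real (E i)ᶜ) l (𝓝 0)) :
    Tendsto (fun i => μ i (E i)) l (𝓝 1) := by
  have hcompl : Tendsto (fun i => μ i (E i)ᶜ) l (𝓝 0) := by
    simpa using ENNReal.tendsto_ofReal h
  have hsub : Tendsto (fun i => 1 - μ i (E i)ᶜ) l (𝓝 1) := by
    simpa using ENNReal.Tendsto.sub tendsto_const_nhds hcompl (Or.inl ENNReal.one_ne_top)
  refine tendsto_of_tendsto_of_tendsto_of_le_of_le hsub tendsto_const_nhds (fun i => ?_)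
    fun i => prob_le_one
  rw [tsub_le_iff_right, ← measure_univ (μ := μ i), ← Set.union_compl_self (E i)]
  exact measure_union_le _ _

theorem tendsto_measure_one_mono (hE : Tendsto (fun i => μ i (E i)) l (𝓝 1))
    (h : ∀ᶠ i in l, E i ⊆ F i) : Tendsto (fun i => μ i (F i)) l (𝓝 1) :=
  tendsto_of_tendsto_of_tendsto_of_le_of_le' hE tendsto_const_nhds
    (h.mono fun _ hi => measure_mono hi) (.of_forall fun _ => prob_le_one)

end

variable {p : ℕ → unitInterval} {a b : ℝ}

open Classical in
theorem tendsto_binomialRandom_real_exists_lt_degree (hpb : ∀ᶠ n : ℕ in atTop, n * (p n : ℝ) ≤ b) :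
    Tendsto (fun n : ℕ => (SimpleGraph.binomialRandom (Fin n) (p n)).real
      {G | ∃ v, 4 * (Real.log n / Real.log (Real.log n)) < G.degree v}) atTop (𝓝 0) := by
  refine tendsto_of_tendsto_of_tendsto_of_le_of_le' tendsto_const_nhds
    ((tendsto_exp_mul_sqrt_sub b).comp tendsto_log_natCast_atTop)
    (.of_forall fun n => measureReal_nonneg) ?_
  filter_upwards [hpb, eventually_gt_atTop 0, tendsto_log_natCast_atTop.eventually_gt_atTop 1]
    with n hpb hn hlog
  have hp : (0 : ℝ) ≤ p n := (p n).2.1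
  set r := ⌈4 * (Real.log n / Real.log (Real.log n))⌉₊
  calc _ ≤ (SimpleGraph.binomialRandom (Fin n) (p n)).real {G | ∃ v, r ≤ G.degree v} :=
        measureReal_mono (Set.ofPred_subset_ofPred.2 fun G hG =>
          hG.imp fun v hv => Nat.ceil_le.2 hv.le)
    _ ≤ n * (n.choose r * (p n : ℝ) ^ r) := by
        simpa only [Fintype.card_fin] using
          binomialRandom_real_exists_le_degree_le (V := Fin n) (p := p n) r
    _ ≤ n * (b ^ r / r.factorial) := by
        gcongr
        exact choose_mul_pow_le_pow_div_factorial hp hpb r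
    _ ≤ Real.exp (Real.log n) * Real.exp (b * √(Real.log n) - 2 * Real.log n) := by
        rw [Real.exp_log (by exact_mod_cast hn)]
        gcongr
        exact pow_div_factorial_le_exp_mul_sqrt_sub ((by positivity : (0 : ℝ) ≤ n * p n).trans hpb)
          hlog (Nat.le_ceil _)
    _ = Real.exp (b * √(Real.log n) - Real.log n) := by
        rw [← Real.exp_add]
        ring_nf

open Classical in
theorem binomialRandom_fin_real_maxDegree_lt_le {n : ℕ} {p : unitInterval} (r : ℕ) :
    (SimpleGraph.binomialRandom (Fin n) p).real {G | G.maxDegree < r} ≤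
      Real.exp (-((n / 2 : ℕ) *
        ((n - n / 2).choose r * (p : ℝ) ^ r * (1 - p) ^ (n - n / 2 - r)))) := by
  obtain ⟨A, -, hA⟩ := Finset.exists_subset_card_eq (s := (Finset.univ : Finset (Fin n)))
    (n := n / 2) (by simpa using Nat.div_le_self n 2)
  simpa only [Finset.card_compl, hA, Fintype.card_fin] using
    binomialRandom_real_maxDegree_lt_le (p := p) (disjoint_compl_right (a := A)) r

open Classical in
theorem tendsto_binomialRandom_real_maxDegree_lt (ha : 0 < a)
    (hap : ∀ᶠ n : ℕ in atTop, a ≤ n * (p n : ℝ)) (hpb : ∀ᶠ n : ℕ in atTop, n * (p n : ℝ) ≤ b) :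
    Tendsto (fun n : ℕ => (SimpleGraph.binomialRandom (Fin n) (p n)).real
      {G | G.maxDegree < ⌊Real.log n / Real.log (Real.log n) / 2⌋₊}) atTop (𝓝 0) := by
  have hbound : Tendsto (fun n : ℕ => Real.exp
      (-(Real.exp (Real.log n / 4) * (Real.exp (-(2 * b)) / 4)))) atTop (𝓝 0) :=
    Real.tendsto_exp_neg_atTop_nhds_zero.comp
      ((Real.tendsto_exp_atTop.comp
        (tendsto_log_natCast_atTop.atTop_div_const (by norm_num))).atTop_mul_const (by positivity))
  refine tendsto_of_tendsto_of_tendsto_of_le_of_le' tendsto_const_nhds hbound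
    (.of_forall fun n => measureReal_nonneg) ?_
  filter_upwards [hap, hpb, eventually_ge_atTop 2,
    tendsto_natCast_atTop_atTop.eventually_ge_atTop (2 * b),
    tendsto_log_log_natCast_atTop.eventually_ge_atTop 1,
    tendsto_log_log_natCast_atTop.eventually_ge_atTop (2 * |Real.log (a / 4)|),
    eventually_floor_half_log_div_log_log_le] with n hap hpb hn hnb hlog hax hr
  have hn0 : (0 : ℝ) < n := by positivity
  have hp2 : (p n : ℝ) ≤ 1 / 2 := le_of_mul_le_mul_left (by linarith) hn0
  refine (binomialRandom_fin_real_maxDegree_lt_le _).trans (Real.exp_le_exp.2 (neg_le_neg ?_))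
  exact exp_quarter_mul_le_half_mul_choose_mul hn hr.1 ha (p n).2.1 hp2 hap hpb hlog hax hr.2

open Classical in
theorem tendsto_binomialRandom_maxDegree (ha : 0 < a)
    (hap : ∀ᶠ n : ℕ in atTop, a ≤ n * (p n : ℝ)) (hpb : ∀ᶠ n : ℕ in atTop, n * (p n : ℝ) ≤ b) :
    Tendsto (fun n : ℕ => SimpleGraph.binomialRandom (Fin n) (p n)
      {G | ⌊Real.log n / Real.log (Real.log n) / 2⌋₊ ≤ G.maxDegree ∧
        ∀ v, G.degree v ≤ 4 * (Real.log n / Real.log (Real.log n))}) atTop (𝓝 1) := by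
  have hsum := (tendsto_binomialRandom_real_maxDegree_lt ha hap hpb).add
    (tendsto_binomialRandom_real_exists_lt_degree hpb)
  rw [add_zero] at hsum
  refine tendsto_measure_one_of_compl
    (squeeze_zero (fun n => measureReal_nonneg) (fun n => ?_) hsum)
  refine (measureReal_mono fun G hG => ?_).trans (measureReal_union_le _ _)
  simpa [or_iff_not_imp_left] using hG

end WithHighProbability

theorem theorem12_general (k : ℕ) (hk : 2 ≤ k) :
    ∃ C₁ C₂ : ℝ, 0 < C₁ ∧ 0 < C₂ ∧
      ∀ (a b : ℝ) (p : ℕ → unitInterval), 0 < a → (∀ᶠ n : ℕ in atTop, a ≤ n * (p n : ℝ)) →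
        (∀ᶠ n : ℕ in atTop, n * (p n : ℝ) ≤ b) →
        Tendsto
          (fun n : ℕ => SimpleGraph.binomialRandom (Fin n) (p n)
            {G : SimpleGraph (Fin n) | ∀ ε : ℝ, 1 ≤ ε → ∀ c : ℕ, 3 ≤ c →
              ENNReal.ofReal (C₁ * (ε * Real.log n / Real.log (Real.log n))) ≤
                ClusteringGame.classPoa
                  (ClusteringGame.equalSplitCoordinationGames G c) ε k ∧
              ClusteringGame.classPoa
                  (ClusteringGame.equalSplitCoordinationGames G c) ε k ≤
                ENNReal.ofReal (C₂ * (ε * Real.log n / Real.log (Real.log n)))})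
          atTop (𝓝 1) := by
  have hk1 : (0 : ℝ) < k - 1 := sub_pos.2 (by exact_mod_cast hk)
  refine ⟨1 / (4 * (k - 1)), 8, by positivity, by norm_num, fun a b p ha hap hpb => ?_⟩
  refine tendsto_measure_one_mono (tendsto_binomialRandom_maxDegree ha hap hpb) ?_
  filter_upwards [(tendsto_div_log_atTop.comp tendsto_log_natCast_atTop).eventually_ge_atTop 8]
    with n hn G hG ε hε c hc
  simpa only [mul_div_assoc, Set.mem_Icc, Function.comp_apply] using
    ClusteringGame.classPoa_mem_Icc_of_maxDegree hc hk hε hn hG.1 hG.2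

theorem eventually_natCast_mul_sparseProb {d : ℝ} (hd : 0 < d) :
    ∀ᶠ n : ℕ in atTop, n * (sparseProb d n : ℝ) = d := by
  filter_upwards [tendsto_natCast_atTop_atTop.eventually_ge_atTop d] with n hn
  have hn0 : (0 : ℝ) < n := hd.trans_le hn
  rw [sparseProb, Set.projIcc_of_mem zero_le_one ⟨by positivity, (div_le_one hn0).2 hn⟩]
  exact mul_div_cancel₀ d hn0.ne'

theorem theorem12 (k : ℕ) (hk : 2 ≤ k) (d : ℝ) (hd : 0 < d) :
    ∃ C₁ C₂ : ℝ, 0 < C₁ ∧ 0 < C₂ ∧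
      ∀ ε : ℝ, 1 ≤ ε → ∀ c : ℕ → ℕ, (∀ n, 3 ≤ c n) →
        Tendsto
          (fun n : ℕ => SimpleGraph.binomialRandom (Fin n) (sparseProb d n)
            {G : SimpleGraph (Fin n) |
              ENNReal.ofReal (C₁ * (ε * Real.log n / Real.log (Real.log n))) ≤
                ClusteringGame.classPoa
                  (ClusteringGame.equalSplitCoordinationGames G (c n)) ε k ∧
              ClusteringGame.classPoa
                  (ClusteringGame.equalSplitCoordinationGames G (c n)) ε k ≤
                ENNReal.ofReal (C₂ * (ε * Real.log n / Real.log (Real.log n)))})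
          atTop (𝓝 1) := by
  obtain ⟨C₁, C₂, hC₁, hC₂, h⟩ := theorem12_general k hk
  have hp := eventually_natCast_mul_sparseProb hd
  exact ⟨C₁, C₂, hC₁, hC₂, fun ε hε c hc => tendsto_measure_one_mono
    (h d d _ hd (hp.mono fun _ => Eq.ge) (hp.mono fun _ => Eq.le))
    (.of_forall fun n G hG => hG ε hε (c n) (hc n))⟩
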